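/- Consider a transmitter with $N_T$ antennas, $K$ single-antenna receivers with channels $h_k\in\mathbb C^{N_T}$ and $M$ potential eavesdroppers with channels $G_m\in\mathbb C^{N_T\times N_R}$. Let $\sigma_a^2,\sigma_s^2>0$ be noise variances, $\eta>0$ the energy conversion efficiency, and let $\Gamma_k>0$, $R_{m,k}>0$, $P_k,P_{I,m}\in\mathbb R$ be given for all $k,m$. Put $\xi_{m,k}=2^{R_{m,k}}$ and $Q_m(V)=G_m^HVG_m+(\sigma_a^2+\sigma_s^2)I$. *Original problem* (variables $w_k\in\mathbb C^{N_T}$, $V\in\mathbb H^{N_T}$, $\rho_k\in\mathbb R$): minimize $\sum_k\|w_k\|^2+\operatorname{Tr}V$ subject to, for all $k,m$: (C1) $\dfrac{\rho_k|h_k^Hw_k|^2}{\rho_k\left(\sum_{j\ne k}|h_k^Hw_j|^2+\operatorname{Tr}(h_kh_k^HV)+\sigma_a^2\right)+\sigma_s^2}\ge\Gamma_k$; (C2) $\log_2\det\left(I+Q_m(V)^{-1}G_m^Hw_kw_k^HG_m\right)\le R_{m,k}$; (C3) $\eta(1-\rho_k)\left(\sum_j|h_k^Hw_j|^2+\operatorname{Tr}(h_kh_k^HV)+\sigma_a^2\right)\ge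 P_k$; (C4) $\eta\left(\sum_k\operatorname{Tr}(G_m^Hw_kw_k^HG_m)+\operatorname{Tr}(G_mG_m^HV)+N_R\sigma_a^2\right)\ge P_{I,m}$; (C5) $0\le\rho_k\le1$; (C6) $V\succeq0$. *SDP relaxation* (variables $W_k,V\in\mathbb H^{N_T}$, $\rho_k\in\mathbb R$): minimize $\sum_k\operatorname{Tr}W_k+\operatorname{Tr}V$ subject to (C5), (C6), $W_k\succeq0$ and, for all $k,m$, $\frac1{\Gamma_k}\operatorname{Tr}(h_kh_k^HW_k)-\sum_{j\ne k}\operatorname{Tr}(h_kh_k^HW_j)-\operatorname{Tr}(h_kh_k^HV)\ge\sigma_a^2+\frac{\sigma_s^2}{\rho_k}$; $G_m^HW_kG_m\preceq(\xi_{m,k}-1)Q_m(V)$; $\operatorname{Tr}\left(h_kh_k^H(V+\sum_jW_j)\right)\ge\frac{P_k}{\eta(1-\rho_k)}-\sigma_a^2$; $\operatorname{Tr}\left(G_m^H(V+\sum_kW_k)G_m\right)\ge\frac{P_{I,m}}{\eta}-N_R\sigma_a^2$. Here the first constraint fails at $\rho_k=0$; at $\rho_k=1$ the third one fails if $P_k>0$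 and holds if $P_k\le0$. *Dual variables.* Let $\alpha_k,\beta_k,\nu_m\ge0$ and $X_{m,k},Y,Z_k\succeq0$ be Lagrange multipliers of, respectively, the first, third and fourth displayed constraints, and of the second displayed constraint, $V\succeq0$ and $W_k\succeq0$. They form an *optimal dual solution* if the infimum of the Lagrangian over Hermitian $W_k,V$ and $\rho_k\in(0,1)$ is at least the optimal primal value (no duality gap). Put $$U_k=I+\sum_mG_m(X_{m,k}-\nu_mI)G_m^H+\sum_{j\ne k}(\alpha_j-\beta_j)h_jh_j^H.$$ **Theorem 1.** (a) Let $(W^*,V^*,\rho^*)$ be an optimal solution of the SDP relaxation with $\operatorname{rank}W_k^*>1$ for some $k$. Then there is a feasible, hence also optimal, solution $(\widetilde W,\widetilde V,\widetilde\rho)$ of the relaxation with the same objective value and $\operatorname{rank}\widetilde W_k=1$ for all $k$. It can be chosen so that $\widetilde\rho=\rho^*$, $W_k^*-\widetilde W_k\succeq0$ for all $k$, $\widetilde V=V^*+\sum_k(W_k^*-\widetilde W_k)$, and $U_k(W_k^*-\widetilde W_k)=0$ for all $k$ and every optimal dual solution; that is, components of $W_k^*$ in the null space of $U_k$ are moved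 into $V$. (b) The relaxation is tight. If $(W,V,\rho)$ is optimal for the relaxation and $\operatorname{rank}W_k=1$ for all $k$, then $W_k=w_kw_k^H$ for some vectors $w_k$ such that $(w,V,\rho)$ is a global optimum of the original problem with the same objective value. Conversely, if $(w,V,\rho)$ is a global optimum of the original problem, then $((w_kw_k^H)_k,V,\rho)$ is optimal for the relaxation. A real number is the minimum value of one problem if and only if it is the minimum value of the other. -/

import Mathlib

open Matrix
open scoped ComplexOrder

noncomputable section

/-- Data of a multiuser downlink system with `NT` transmit antennas, `K` single-antenna desired
receivers and `M` roaming receivers (potential eavesdroppers) with `NR` antennas each. -/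
structure WIPTSystem (NT NR K M : ℕ) where
  /-- channel vectors of the desired receivers -/
  h : Fin K → Fin NT → ℂ
  /-- channel matrices of the roaming receivers -/
  G : Fin M → Matrix (Fin NT) (Fin NR) ℂ
  /-- antenna noise variance -/
  sigAnt2 : ℝ
  /-- signal processing noise variance -/
  sigS2 : ℝ
  /-- energy conversion efficiency -/
  eta : ℝ
  /-- required SINRs of the desired receivers -/
  Greq : Fin K → ℝ
  /-- maximum tolerable rates at the eavesdroppers -/
  Reav : Fin M → Fin K → ℝ
  /-- minimum harvested powers at the desired receivers -/
  Pmin : Fin K → ℝ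
  /-- minimum harvested powers at the roaming receivers -/
  PI : Fin M → ℝ

/-- The trace, as a real number. It is only applied to products whose trace is real. -/
def rtr {n : ℕ} (A : Matrix (Fin n) (Fin n) ℂ) : ℝ := (Matrix.trace A).re

/-- The rank-one matrix `w wᴴ`. -/
def outer {n : ℕ} (w : Fin n → ℂ) : Matrix (Fin n) (Fin n) ℂ := Matrix.vecMulVec w (star w)

/-- `‖w‖²` for the Euclidean norm. -/
def normSq2 {n : ℕ} (w : Fin n → ℂ) : ℝ := ∑ i, ‖w i‖ ^ 2

namespace WIPTSystem

variable {NT NR K M : ℕ} (S : WIPTSystem NT NR K M)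

/-- `h_k h_kᴴ`. -/
def H (k : Fin K) : Matrix (Fin NT) (Fin NT) ℂ := outer (S.h k)

/-- `Q_m = G_mᴴ V G_m + (σ_ant² + σ_s²) I`. -/
def Q (V : Matrix (Fin NT) (Fin NT) ℂ) (m : Fin M) : Matrix (Fin NR) (Fin NR) ℂ :=
  (S.G m)ᴴ * V * S.G m + ((S.sigAnt2 + S.sigS2 : ℝ) : ℂ) • (1 : Matrix (Fin NR) (Fin NR) ℂ)

/-- `ξ_{m,k} = 2 ^ R_{m,k}`. -/
def xi (m : Fin M) (k : Fin K) : ℝ := (2 : ℝ) ^ (S.Reav m k)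

/-! ### The original nonconvex problem, in the beamforming vectors -/

/-- Receive SINR at desired receiver `k`. -/
def sinr (w : Fin K → Fin NT → ℂ) (V : Matrix (Fin NT) (Fin NT) ℂ) (ρ : Fin K → ℝ)
    (k : Fin K) : ℝ :=
  ρ k * ‖star (S.h k) ⬝ᵥ w k‖ ^ 2 /
    (ρ k * (∑ j ∈ Finset.univ.erase k, ‖star (S.h k) ⬝ᵥ w j‖ ^ 2 + rtr (S.H k * V) + S.sigAnt2)
      + S.sigS2)

/-- Worst-case capacity of roaming receiver `m` for the signal of receiver `k`; the determinant
is real (and at least one) when `V` is positive semidefinite. -/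
def eveCapacity (w : Fin K → Fin NT → ℂ) (V : Matrix (Fin NT) (Fin NT) ℂ)
    (m : Fin M) (k : Fin K) : ℝ :=
  Real.logb 2 (Matrix.det (1 + (S.Q V m)⁻¹ * ((S.G m)ᴴ * outer (w k) * S.G m))).re

/-- Energy harvested by desired receiver `k`. -/
def harvested (w : Fin K → Fin NT → ℂ) (V : Matrix (Fin NT) (Fin NT) ℂ) (ρ : Fin K → ℝ)
    (k : Fin K) : ℝ :=
  S.eta * (1 - ρ k) * (∑ j, ‖star (S.h k) ⬝ᵥ w j‖ ^ 2 + rtr (S.H k * V) + S.sigAnt2)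

/-- Feasible points of the original problem. -/
structure OrigFeasible (w : Fin K → Fin NT → ℂ) (V : Matrix (Fin NT) (Fin NT) ℂ)
    (ρ : Fin K → ℝ) : Prop where
  C1 : ∀ k, S.Greq k ≤ S.sinr w V ρ k
  C2 : ∀ m k, S.eveCapacity w V m k ≤ S.Reav m k
  C3 : ∀ k, S.Pmin k ≤ S.harvested w V ρ k
  C4 : ∀ m, S.PI m ≤ S.eta * (∑ k, rtr ((S.G m)ᴴ * outer (w k) * S.G m)
    + rtr (S.G m * (S.G m)ᴴ * V) + NR * S.sigAnt2)
  C5 : ∀ k, 0 ≤ ρ k ∧ ρ k ≤ 1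
  C6 : V.PosSemidef

/-- Total transmit power, in the beamforming vectors. -/
def origObj (w : Fin K → Fin NT → ℂ) (V : Matrix (Fin NT) (Fin NT) ℂ) : ℝ :=
  ∑ k, normSq2 (w k) + rtr V

/-- Global optimal solutions of the original problem. -/
def IsOptimalOrig (w : Fin K → Fin NT → ℂ) (V : Matrix (Fin NT) (Fin NT) ℂ)
    (ρ : Fin K → ℝ) : Prop :=
  S.OrigFeasible w V ρ ∧
    ∀ w₁ V₁ ρ₁, S.OrigFeasible w₁ V₁ ρ₁ → origObj w V ≤ origObj w₁ V₁

/-! ### The SDP relaxation (the rank constraint is dropped) -/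

/-- Feasible points of the SDP relaxation. The right-hand side of `C1` is `+∞` at `ρ k = 0`; the
quotient in `C3` is `+∞` at `ρ k = 1` if `Pmin k > 0`, and nothing is required there otherwise. -/
structure SDPFeasible (W : Fin K → Matrix (Fin NT) (Fin NT) ℂ)
    (V : Matrix (Fin NT) (Fin NT) ℂ) (ρ : Fin K → ℝ) : Prop where
  C1 : ∀ k, 0 < ρ k ∧
    S.sigAnt2 + 1 / ρ k * S.sigS2 ≤
      1 / S.Greq k * rtr (S.H k * W k) - ∑ j ∈ Finset.univ.erase k, rtr (S.H k * W j)
        - rtr (S.H k * V)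
  C2 : ∀ m k, (((S.xi m k - 1 : ℝ) : ℂ) • S.Q V m - (S.G m)ᴴ * W k * S.G m).PosSemidef
  C3 : ∀ k, (ρ k = 1 ∧ S.Pmin k ≤ 0) ∨ (ρ k < 1 ∧
    S.Pmin k / (S.eta * (1 - ρ k)) - S.sigAnt2 ≤ rtr (S.H k * (V + ∑ j, W j)))
  C4 : ∀ m, S.PI m / S.eta - NR * S.sigAnt2 ≤ rtr ((S.G m)ᴴ * (V + ∑ k, W k) * S.G m)
  C5 : ∀ k, 0 ≤ ρ k ∧ ρ k ≤ 1
  C6 : V.PosSemidef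
  C7 : ∀ k, (W k).PosSemidef

/-- Total transmit power, in the covariance matrices. -/
def sdpObj (W : Fin K → Matrix (Fin NT) (Fin NT) ℂ) (V : Matrix (Fin NT) (Fin NT) ℂ) : ℝ :=
  ∑ k, rtr (W k) + rtr V

/-- Optimal solutions of the SDP relaxation. -/
def IsOptimalSDP (W : Fin K → Matrix (Fin NT) (Fin NT) ℂ) (V : Matrix (Fin NT) (Fin NT) ℂ)
    (ρ : Fin K → ℝ) : Prop :=
  S.SDPFeasible W V ρ ∧
    ∀ W₁ V₁ ρ₁, S.SDPFeasible W₁ V₁ ρ₁ → sdpObj W V ≤ sdpObj W₁ V₁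

/-! ### Lagrangian duality for the relaxation -/

/-- Dual variables: `α`, `β`, `ν` for `C1`, `C3`, `C4` and `X`, `Y`, `Z` for `C2`, `C6`, `C7`. -/
structure Dual (NT NR K M : ℕ) where
  α : Fin K → ℝ
  β : Fin K → ℝ
  ν : Fin M → ℝ
  X : Fin M → Fin K → Matrix (Fin NR) (Fin NR) ℂ
  Y : Matrix (Fin NT) (Fin NT) ℂ
  Z : Fin K → Matrix (Fin NT) (Fin NT) ℂ

/-- The Lagrangian of the relaxation (meaningful for `0 < ρ k < 1`). -/
def lagrangian (D : Dual NT NR K M) (W : Fin K → Matrix (Fin NT) (Fin NT) ℂ)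
    (V : Matrix (Fin NT) (Fin NT) ℂ) (ρ : Fin K → ℝ) : ℝ :=
  ∑ k, rtr (W k) + rtr V - rtr (D.Y * V) - ∑ k, rtr (D.Z k * W k)
  + ∑ k, D.α k * (-(1 / S.Greq k) * rtr (S.H k * W k)
      + ∑ j ∈ Finset.univ.erase k, rtr (S.H k * W j) + rtr (S.H k * V)
      + S.sigAnt2 + 1 / ρ k * S.sigS2)
  + ∑ k, D.β k * (S.Pmin k / (S.eta * (1 - ρ k)) - S.sigAnt2
      - rtr (S.H k * (V + ∑ j, W j)))
  + ∑ m, D.ν m * (S.PI m / S.eta - NR * S.sigAnt2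
      - rtr (S.G m * (S.G m)ᴴ * (V + ∑ k, W k)))
  + ∑ m, ∑ k, rtr (D.X m k *
      ((S.G m)ᴴ * W k * S.G m - ((S.xi m k - 1 : ℝ) : ℂ) • S.Q V m))

/-- `D` is an optimal dual solution belonging to the optimal primal solution `(W, V, _)`: it is
dual feasible, and its dual value, the infimum of the Lagrangian, reaches the optimal primal value
(there is no duality gap). -/
structure IsOptimalDual (W : Fin K → Matrix (Fin NT) (Fin NT) ℂ)
    (V : Matrix (Fin NT) (Fin NT) ℂ) (D : Dual NT NR K M) : Prop where
  α_nonneg : ∀ k, 0 ≤ D.α k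
  β_nonneg : ∀ k, 0 ≤ D.β k
  ν_nonneg : ∀ m, 0 ≤ D.ν m
  X_psd : ∀ m k, (D.X m k).PosSemidef
  Y_psd : D.Y.PosSemidef
  Z_psd : ∀ k, (D.Z k).PosSemidef
  value : ∀ (W₁ : Fin K → Matrix (Fin NT) (Fin NT) ℂ) (V₁ : Matrix (Fin NT) (Fin NT) ℂ)
    (ρ₁ : Fin K → ℝ), (∀ k, (W₁ k).IsHermitian) → V₁.IsHermitian →
    (∀ k, 0 < ρ₁ k ∧ ρ₁ k < 1) → sdpObj W V ≤ S.lagrangian D W₁ V₁ ρ₁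

/-- `U_k = I + ∑_m G_m (X_{m,k} - ν_m I) G_mᴴ + ∑_{j ≠ k} (α_j - β_j) h_j h_jᴴ`. -/
def U (D : Dual NT NR K M) (k : Fin K) : Matrix (Fin NT) (Fin NT) ℂ :=
  1 + ∑ m, S.G m * (D.X m k - (D.ν m : ℂ) • (1 : Matrix (Fin NR) (Fin NR) ℂ)) * (S.G m)ᴴ
    + ∑ j ∈ Finset.univ.erase k, ((D.α j - D.β j : ℝ) : ℂ) • S.H j

end WIPTSystem

end

/-! Constraint C1 forces `t = h_kᴴ W_k h_k > 0`, because the noise terms are positive. So `W_k` has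
a rank-one part `W_k h_k h_kᴴ W_k / t`, which lies below `W_k` in the Loewner order and satisfies
`H_k * rankOnePart = H_k * W_k`. Move every remainder `W_k - rankOnePart` into `V`. The total `V + ∑
W_k` is unchanged, hence so are the objective, C3 and C4. In C1 both the own signal and the total
received power are unchanged. In C2 the left side decreases and `Q_m` increases, with `ξ - 1 > 0`
(`SDPFeasible.move`).

At rank-one points the relaxed constraints are the original ones (`origFeasible_iff`): the
determinant lemma turns the rate bound into `gᴴ Q⁻¹ g ≤ ξ - 1` with `g = G_mᴴ w_k`, which is
equivalent to `g gᴴ ⪯ (ξ - 1) Q`. Both problems therefore attain the same set of objective values.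

For the null space claim, the Lagrangian is affine in `W_k`. Being bounded below, it has zero
coefficient, so `U_k = Z_k + (α_k / Γ_k + β_k) H_k`. The remainder is annihilated by `H_k`, and by
`Z_k` through complementary slackness. -/

noncomputable section

/-! ### Real traces and outer products -/

lemma rtr_add {n : ℕ} (A B : Matrix (Fin n) (Fin n) ℂ) : rtr (A + B) = rtr A + rtr B := by
  simp [rtr, trace_add]

lemma rtr_sub {n : ℕ} (A B : Matrix (Fin n) (Fin n) ℂ) : rtr (A - B) = rtr A - rtr B := by
  simp [rtr, trace_sub]

lemma rtr_zero {n : ℕ} : rtr (0 : Matrix (Fin n) (Fin n) ℂ) = 0 := by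
  simp [rtr]

lemma rtr_sum {n : ℕ} {ι : Type*} (s : Finset ι) (A : ι → Matrix (Fin n) (Fin n) ℂ) :
    rtr (∑ i ∈ s, A i) = ∑ i ∈ s, rtr (A i) := by
  simp [rtr, trace_sum]

lemma rtr_smul {n : ℕ} (c : ℝ) (A : Matrix (Fin n) (Fin n) ℂ) :
    rtr ((c : ℂ) • A) = c * rtr A := by
  simp [rtr, trace_smul]

lemma rtr_mul_comm {n m : ℕ} (A : Matrix (Fin n) (Fin m) ℂ) (B : Matrix (Fin m) (Fin n) ℂ) :
    rtr (A * B) = rtr (B * A) := by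
  rw [rtr, trace_mul_comm, rtr]

lemma rtr_nonneg {n : ℕ} {A : Matrix (Fin n) (Fin n) ℂ} (hA : A.PosSemidef) : 0 ≤ rtr A :=
  (Complex.nonneg_iff.mp hA.trace_nonneg).1

lemma posSemidef_outer {n : ℕ} (w : Fin n → ℂ) : (outer w).PosSemidef :=
  posSemidef_vecMulVec_self_star w

lemma trace_outer_mul {n : ℕ} (w : Fin n → ℂ) (A : Matrix (Fin n) (Fin n) ℂ) :
    trace (outer w * A) = star w ⬝ᵥ A *ᵥ w := by
  rw [trace_mul_comm, outer, mul_vecMulVec, trace_vecMulVec, dotProduct_comm]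

/-- The trace of `w wᴴ A` as a real number determines `wᴴ A w` when `A` is Hermitian. -/
lemma star_dotProduct_mulVec_eq_rtr {n : ℕ} {A : Matrix (Fin n) (Fin n) ℂ} (hA : A.IsHermitian)
    (w : Fin n → ℂ) : star w ⬝ᵥ A *ᵥ w = (rtr (outer w * A) : ℂ) := by
  rw [rtr, trace_outer_mul]
  refine (Complex.conj_eq_iff_re.mp ?_).symm
  rw [← Complex.star_def, ← star_dotProduct, star_mulVec, hA.eq, ← dotProduct_mulVec]

lemma rtr_outer_mul_nonneg {n : ℕ} {A : Matrix (Fin n) (Fin n) ℂ} (hA : A.PosSemidef)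
    (w : Fin n → ℂ) : 0 ≤ rtr (outer w * A) := by
  rw [rtr, trace_outer_mul]
  exact hA.re_dotProduct_nonneg w

lemma rtr_mul_nonneg {n : ℕ} {A B : Matrix (Fin n) (Fin n) ℂ} (hA : A.PosSemidef)
    (hB : B.PosSemidef) : 0 ≤ rtr (A * B) := by
  obtain ⟨m, v, rfl⟩ := posSemidef_iff_eq_sum_vecMulVec.mp hB
  rw [rtr_mul_comm, Finset.sum_mul, rtr_sum]
  exact Finset.sum_nonneg fun i _ => rtr_outer_mul_nonneg hA (v i)

/-- Write `B = ∑ v_i v_iᴴ`. The trace is a sum of nonnegative terms `v_iᴴ A v_i`; each vanishes, and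
semidefiniteness of `A` then gives `A v_i = 0`. -/
lemma mul_eq_zero_of_rtr_eq_zero {n : ℕ} {A B : Matrix (Fin n) (Fin n) ℂ} (hA : A.PosSemidef)
    (hB : B.PosSemidef) (h : rtr (A * B) = 0) : A * B = 0 := by
  obtain ⟨m, v, rfl⟩ := posSemidef_iff_eq_sum_vecMulVec.mp hB
  simp only [← outer.eq_1] at h ⊢
  rw [rtr_mul_comm, Finset.sum_mul, rtr_sum,
    Finset.sum_eq_zero_iff_of_nonneg fun i _ => rtr_outer_mul_nonneg hA (v i)] at h
  rw [Finset.mul_sum]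
  refine Finset.sum_eq_zero fun i hi => ?_
  have h0 : A *ᵥ v i = 0 := by
    rw [← hA.dotProduct_mulVec_zero_iff, star_dotProduct_mulVec_eq_rtr hA.1]
    exact_mod_cast h i hi
  rw [outer, mul_vecMulVec, h0, zero_vecMulVec]

lemma rtr_outer {n : ℕ} (w : Fin n → ℂ) : rtr (outer w) = normSq2 w := by
  simp only [rtr, outer, normSq2, trace_vecMulVec, dotProduct, Complex.re_sum, Pi.star_apply,
    Complex.star_def, Complex.mul_conj, Complex.ofReal_re, Complex.normSq_eq_norm_sq]

lemma rtr_outer_mul_outer {n : ℕ} (v w : Fin n → ℂ) :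
    rtr (outer v * outer w) = ‖star v ⬝ᵥ w‖ ^ 2 := by
  rw [rtr, trace_outer_mul, outer, vecMulVec_mulVec, op_smul_eq_smul, dotProduct_smul,
    smul_eq_mul]
  have : star w ⬝ᵥ v = star (star v ⬝ᵥ w) := star_dotProduct _ _
  rw [this, Complex.star_def, ← Complex.normSq_eq_conj_mul_self, Complex.ofReal_re,
    Complex.normSq_eq_norm_sq]

lemma outer_smul {n : ℕ} (c : ℝ) (w : Fin n → ℂ) :
    outer ((c : ℂ) • w) = ((c ^ 2 : ℝ) : ℂ) • outer w := by
  rw [outer, star_smul, smul_vecMulVec, vecMulVec_smul, smul_smul, outer]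
  simp [pow_two]

lemma conjTranspose_mul_outer_mul {n m : ℕ} (G : Matrix (Fin n) (Fin m) ℂ) (w : Fin n → ℂ) :
    Gᴴ * outer w * G = outer (Gᴴ *ᵥ w) := by
  rw [outer, mul_vecMulVec, vecMulVec_mul, outer, star_mulVec, conjTranspose_conjTranspose]

/-! ### The rank-one part of a positive semidefinite matrix -/

/-- A vector whose outer product is the rank-one part `W h hᴴ W / (hᴴ W h)` of `W`. -/
def rankOneVec {n : ℕ} (h : Fin n → ℂ) (W : Matrix (Fin n) (Fin n) ℂ) : Fin n → ℂ :=
  (((√(rtr (outer h * W)))⁻¹ : ℝ) : ℂ) • W *ᵥ h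

lemma outer_mulVec {n : ℕ} {W : Matrix (Fin n) (Fin n) ℂ} (hW : W.IsHermitian) (h : Fin n → ℂ) :
    outer (W *ᵥ h) = W * outer h * W := by
  conv_rhs => enter [1, 1]; rw [← hW.eq]
  rw [conjTranspose_mul_outer_mul, hW.eq]

lemma outer_rankOneVec {n : ℕ} {h : Fin n → ℂ} {W : Matrix (Fin n) (Fin n) ℂ}
    (hW : W.PosSemidef) :
    outer (rankOneVec h W) = (((rtr (outer h * W))⁻¹ : ℝ) : ℂ) • (W * outer h * W) := by
  rw [rankOneVec, outer_smul, outer_mulVec hW.1, inv_pow,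
    Real.sq_sqrt (rtr_outer_mul_nonneg hW h)]

lemma outer_mul_mul_outer {n : ℕ} {W : Matrix (Fin n) (Fin n) ℂ} (hW : W.IsHermitian)
    (h : Fin n → ℂ) : outer h * W * outer h = (rtr (outer h * W) : ℂ) • outer h := by
  rw [mul_assoc]
  conv_lhs => rw [outer, mul_vecMulVec, vecMulVec_mul_vecMulVec]
  rw [star_dotProduct_mulVec_eq_rtr hW, vecMulVec_smul, outer]

lemma outer_mul_outer_rankOneVec {n : ℕ} {h : Fin n → ℂ} {W : Matrix (Fin n) (Fin n) ℂ}
    (hW : W.PosSemidef) (ht : rtr (outer h * W) ≠ 0) :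
    outer h * outer (rankOneVec h W) = outer h * W := by
  rw [outer_rankOneVec hW, mul_smul_comm, ← mul_assoc, ← mul_assoc, outer_mul_mul_outer hW.1,
    smul_mul_assoc, smul_smul, ← Complex.ofReal_mul, inv_mul_cancel₀ ht, Complex.ofReal_one,
    one_smul]

/-- Removing the rank-one part keeps a positive semidefinite matrix positive semidefinite. -/
lemma posSemidef_sub_outer_rankOneVec {n : ℕ} {h : Fin n → ℂ} {W : Matrix (Fin n) (Fin n) ℂ}
    (hW : W.PosSemidef) (ht : rtr (outer h * W) ≠ 0) :
    (W - outer (rankOneVec h W)).PosSemidef := by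
  set t := rtr (outer h * W) with htdef
  -- The remainder is the congruence `Pᴴ W P` by the oblique projection `P = 1 - t⁻¹ h hᴴ W`, which
  -- annihilates `h`.
  have key : (1 - ((t⁻¹ : ℝ) : ℂ) • (outer h * W))ᴴ * W * (1 - ((t⁻¹ : ℝ) : ℂ) • (outer h * W))
      = W - outer (rankOneVec h W) := by
    have h1 : W * outer h * W * (outer h * W) = (t : ℂ) • (W * outer h * W) := by
      have := outer_mul_mul_outer hW.1 h
      calc W * outer h * W * (outer h * W) = W * (outer h * W * outer h) * W := by
            simp only [mul_assoc]
        _ = _ := by rw [this, mul_smul_comm, smul_mul_assoc]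
    rw [conjTranspose_sub, conjTranspose_smul, conjTranspose_mul, hW.1.eq, (posSemidef_outer h).1.eq,
      conjTranspose_one, outer_rankOneVec hW, Complex.star_def, Complex.conj_ofReal]
    simp only [sub_mul, mul_sub, one_mul, mul_one, smul_mul_assoc, mul_smul_comm, h1, smul_smul,
      ← Complex.ofReal_mul]
    rw [inv_mul_cancel₀ ht, Complex.ofReal_one, one_smul, mul_assoc, sub_self, smul_zero, sub_zero]
  rw [← key]
  exact hW.conjTranspose_mul_mul_same _

lemma rank_outer {n : ℕ} {w : Fin n → ℂ} (hw : w ≠ 0) : (outer w).rank = 1 := by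
  refine le_antisymm (rank_vecMulVec_le _ _) (Nat.one_le_iff_ne_zero.mpr fun h => ?_)
  have h0 : outer w = 0 := by
    rw [Matrix.rank, Submodule.finrank_eq_zero, LinearMap.range_eq_bot] at h
    exact Matrix.ext_of_mulVec_single fun i => by
      rw [zero_mulVec, ← mulVecLin_apply, h, LinearMap.zero_apply]
  rw [outer, vecMulVec_eq_zero, star_eq_zero, or_self] at h0
  exact hw h0

/-- A positive semidefinite matrix of rank one is its own rank-one part. -/
lemma outer_rankOneVec_of_rank {n : ℕ} {h : Fin n → ℂ} {W : Matrix (Fin n) (Fin n) ℂ}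
    (hW : W.PosSemidef) (ht : rtr (outer h * W) ≠ 0) (hr : W.rank = 1) :
    outer (rankOneVec h W) = W := by
  -- The range is spanned by one vector, so every column is a multiple of it.
  obtain ⟨a, b, hab⟩ : ∃ a b : Fin n → ℂ, W = vecMulVec a b := by
    rw [Matrix.rank, finrank_eq_one_iff'] at hr
    obtain ⟨v, -, hv⟩ := hr
    choose c hc using fun j => hv ⟨W *ᵥ Pi.single j 1, LinearMap.mem_range_self W.mulVecLin _⟩
    refine ⟨v, c, ?_⟩
    ext i j
    have := congrFun (congrArg Subtype.val (hc j)) i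
    simp only [Submodule.coe_smul, Pi.smul_apply, mulVec_single_one, smul_eq_mul] at this
    rw [vecMulVec_apply, mul_comm, this]
    rfl
  have hq := star_dotProduct_mulVec_eq_rtr hW.1 h
  rw [outer_rankOneVec hW]
  have e : W * outer h * W = (rtr (outer h * W) : ℂ) • W := by
    rw [← hq, outer, mul_vecMulVec, vecMulVec_mul]
    nth_rw 1 [hab]
    nth_rw 1 [hab]
    nth_rw 1 [hab]
    nth_rw 1 [hab]
    rw [vecMul_vecMulVec, vecMulVec_mulVec, op_smul_eq_smul, smul_vecMulVec,
      vecMulVec_smul, dotProduct_smul, smul_smul, smul_eq_mul]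
  rw [e, smul_smul, ← Complex.ofReal_mul, inv_mul_cancel₀ ht, Complex.ofReal_one, one_smul]

/-! ### Schur complement criterion and determinant lemma -/

/-- For positive definite `A` and `c > 0`: `g gᴴ ⪯ c A` if and only if `gᴴ A⁻¹ g ≤ c`. -/
lemma posSemidef_smul_sub_outer_iff {n : ℕ} {A : Matrix (Fin n) (Fin n) ℂ} (hA : A.PosDef)
    (g : Fin n → ℂ) {c : ℝ} (hc : 0 ≤ c) :
    ((c : ℂ) • A - outer g).PosSemidef ↔ rtr (outer g * A⁻¹) ≤ c := by
  have hdet : IsUnit A.det := (isUnit_iff_isUnit_det A).mp hA.isUnit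
  have hAi := hA.inv
  set y := A⁻¹ *ᵥ g with hy
  have hAy : A *ᵥ y = g := by rw [hy, mulVec_mulVec, mul_nonsing_inv _ hdet, one_mulVec]
  have hs : rtr (outer y * A) = rtr (outer g * A⁻¹) := by
    rw [hy, outer_mulVec hAi.1, mul_assoc, nonsing_inv_mul _ hdet, mul_one, rtr_mul_comm]
  constructor
  · intro h
    -- Testing with `y = A⁻¹ g` gives `0 ≤ c s - s ^ 2` for `s = gᴴ A⁻¹ g`.
    have h1 := rtr_outer_mul_nonneg h y
    rw [mul_sub, rtr_sub, mul_smul_comm, rtr_smul, hs, rtr_outer_mul_outer] at h1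
    have h2 : ‖star y ⬝ᵥ g‖ = rtr (outer g * A⁻¹) := by
      rw [← hs, ← hAy, star_dotProduct_mulVec_eq_rtr hA.1, Complex.norm_real, Real.norm_eq_abs,
        abs_of_nonneg (rtr_outer_mul_nonneg hA.posSemidef y)]
    rw [h2] at h1
    by_contra! hlt
    nlinarith
  · intro h
    by_cases hg : g = 0
    · have : outer g = 0 := by simp [hg, outer]
      rw [this, sub_zero]
      exact hA.posSemidef.smul (Complex.zero_le_real.mpr hc)
    have hpos : 0 < rtr (outer y * A) := by
      rw [rtr, trace_outer_mul]
      refine hA.re_dotProduct_pos fun h0 => hg ?_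
      rw [← hAy, h0, mulVec_zero]
    -- The rank-one part of `A` in direction `y` is `g gᴴ / s`, so `s A - g gᴴ ⪰ 0`; adding `(c - s)
    -- A` concludes.
    have h1 := posSemidef_sub_outer_rankOneVec hA.posSemidef hpos.ne'
    have h2 := h1.smul (Complex.zero_le_real.mpr hpos.le)
    have h3 := hA.posSemidef.smul (Complex.zero_le_real.mpr (sub_nonneg.mpr h))
    have h4 := h2.add h3
    convert h4 using 1
    rw [outer_rankOneVec hA.posSemidef, ← outer_mulVec hA.1, hAy, smul_sub, smul_smul,
      ← Complex.ofReal_mul, mul_inv_cancel₀ hpos.ne', hs, Complex.ofReal_one, one_smul,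
      Complex.ofReal_sub, sub_smul]
    abel

lemma det_one_add_mul_outer {n : ℕ} (A : Matrix (Fin n) (Fin n) ℂ) (g : Fin n → ℂ) :
    (det (1 + A * outer g)).re = 1 + rtr (outer g * A) := by
  rw [outer, mul_vecMulVec, vecMulVec_eq Unit, det_one_add_replicateCol_mul_replicateRow,
    Complex.add_re, Complex.one_re, rtr, ← outer, trace_outer_mul]

/-! ### Original constraints at rank-one points -/

namespace WIPTSystem

variable {NT NR K M : ℕ} (S : WIPTSystem NT NR K M)

lemma posDef_Q (hsigAnt : 0 < S.sigAnt2) (hsigS : 0 < S.sigS2)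
    {V : Matrix (Fin NT) (Fin NT) ℂ} (hV : V.PosSemidef) (m : Fin M) : (S.Q V m).PosDef := by
  refine PosDef.posSemidef_add (hV.conjTranspose_mul_mul_same _) (PosDef.one.smul ?_)
  exact_mod_cast add_pos hsigAnt hsigS

lemma one_lt_xi {m : Fin M} {k : Fin K} (hR : 0 < S.Reav m k) : 1 < S.xi m k :=
  Real.one_lt_rpow one_lt_two hR

lemma rtr_H_mul_nonneg {V : Matrix (Fin NT) (Fin NT) ℂ} (hV : V.PosSemidef) (k : Fin K) :
    0 ≤ rtr (S.H k * V) :=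
  rtr_outer_mul_nonneg hV _

lemma rtr_H_mul_outer (k : Fin K) (w : Fin NT → ℂ) :
    rtr (S.H k * outer w) = ‖star (S.h k) ⬝ᵥ w‖ ^ 2 :=
  rtr_outer_mul_outer _ _

lemma origObj_eq_sdpObj (w : Fin K → Fin NT → ℂ) (V : Matrix (Fin NT) (Fin NT) ℂ) :
    origObj w V = sdpObj (fun k => outer (w k)) V := by
  simp only [origObj, sdpObj, rtr_outer]

lemma eveCapacity_le_iff (hsigAnt : 0 < S.sigAnt2) (hsigS : 0 < S.sigS2)
    {m : Fin M} {k : Fin K} (hR : 0 < S.Reav m k) (w : Fin K → Fin NT → ℂ)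
    {V : Matrix (Fin NT) (Fin NT) ℂ} (hV : V.PosSemidef) :
    S.eveCapacity w V m k ≤ S.Reav m k ↔
      (((S.xi m k - 1 : ℝ) : ℂ) • S.Q V m - (S.G m)ᴴ * outer (w k) * S.G m).PosSemidef := by
  have hQ := S.posDef_Q hsigAnt hsigS hV m
  have h1 := S.one_lt_xi hR
  have h2 := rtr_outer_mul_nonneg hQ.inv.posSemidef ((S.G m)ᴴ *ᵥ w k)
  rw [eveCapacity, conjTranspose_mul_outer_mul, det_one_add_mul_outer,
    posSemidef_smul_sub_outer_iff hQ _ (by linarith),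
    Real.logb_le_iff_le_rpow one_lt_two (by linarith), ← xi, le_sub_iff_add_le']

lemma le_sinr_iff (hsigAnt : 0 < S.sigAnt2) (hsigS : 0 < S.sigS2)
    {k : Fin K} (hG : 0 < S.Greq k) (w : Fin K → Fin NT → ℂ)
    {V : Matrix (Fin NT) (Fin NT) ℂ} (hV : V.PosSemidef) {ρ : Fin K → ℝ} (hρ : 0 ≤ ρ k) :
    S.Greq k ≤ S.sinr w V ρ k ↔ 0 < ρ k ∧
      S.sigAnt2 + 1 / ρ k * S.sigS2 ≤
        1 / S.Greq k * rtr (S.H k * outer (w k))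
          - ∑ j ∈ Finset.univ.erase k, rtr (S.H k * outer (w j)) - rtr (S.H k * V) := by
  have hI : 0 ≤ ∑ j ∈ Finset.univ.erase k, ‖star (S.h k) ⬝ᵥ w j‖ ^ 2 :=
    Finset.sum_nonneg fun j _ => by positivity
  have hHV := S.rtr_H_mul_nonneg hV k
  simp only [rtr_H_mul_outer]
  rw [sinr]
  generalize ∑ j ∈ Finset.univ.erase k, ‖star (S.h k) ⬝ᵥ w j‖ ^ 2 = I at *
  generalize ‖star (S.h k) ⬝ᵥ w k‖ ^ 2 = p at *
  generalize rtr (S.H k * V) = v at *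
  -- At `ρ k = 0` the SINR is zero, below the positive target.
  rcases hρ.eq_or_lt with h0 | h0
  · simp [← h0, hG]
  have hd : 0 < ρ k * (I + v + S.sigAnt2) + S.sigS2 := by positivity
  rw [le_div_iff₀ hd, and_iff_right h0]
  have e : 1 / S.Greq k * p - I - v - (S.sigAnt2 + 1 / ρ k * S.sigS2)
      = (ρ k * p - S.Greq k * (ρ k * (I + v + S.sigAnt2) + S.sigS2)) / (S.Greq k * ρ k) := by
    field_simp
    ring
  rw [← sub_nonneg (b := S.sigAnt2 + _), e, le_div_iff₀ (mul_pos hG h0), zero_mul, sub_nonneg]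

lemma le_harvested_iff (heta : 0 < S.eta) (w : Fin K → Fin NT → ℂ)
    (V : Matrix (Fin NT) (Fin NT) ℂ) {ρ : Fin K → ℝ} {k : Fin K} (hρ : ρ k ≤ 1) :
    S.Pmin k ≤ S.harvested w V ρ k ↔ (ρ k = 1 ∧ S.Pmin k ≤ 0) ∨ (ρ k < 1 ∧
      S.Pmin k / (S.eta * (1 - ρ k)) - S.sigAnt2 ≤
        rtr (S.H k * (V + ∑ j, outer (w j)))) := by
  rw [mul_add, rtr_add, Finset.mul_sum, rtr_sum, harvested]
  simp only [rtr_H_mul_outer]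
  rcases hρ.eq_or_lt with h1 | h1
  · simp [h1]
  have hd : 0 < S.eta * (1 - ρ k) := mul_pos heta (by linarith)
  rw [or_iff_right (fun h => h1.ne h.1), and_iff_right h1, sub_le_iff_le_add, div_le_iff₀' hd,
    add_comm (rtr _)]

lemma origFeasible_iff (hsigAnt : 0 < S.sigAnt2) (hsigS : 0 < S.sigS2) (heta : 0 < S.eta)
    (hGreq : ∀ k, 0 < S.Greq k) (hReav : ∀ m k, 0 < S.Reav m k)
    {w : Fin K → Fin NT → ℂ} {V : Matrix (Fin NT) (Fin NT) ℂ} {ρ : Fin K → ℝ} :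
    S.OrigFeasible w V ρ ↔ S.SDPFeasible (fun k => outer (w k)) V ρ := by
  have hC4 : ∀ m, S.PI m ≤ S.eta * (∑ k, rtr ((S.G m)ᴴ * outer (w k) * S.G m)
      + rtr (S.G m * (S.G m)ᴴ * V) + NR * S.sigAnt2) ↔
      S.PI m / S.eta - NR * S.sigAnt2 ≤ rtr ((S.G m)ᴴ * (V + ∑ k, outer (w k)) * S.G m) := by
    intro m
    rw [Matrix.mul_add, Matrix.add_mul, rtr_add, Matrix.mul_sum, Matrix.sum_mul, rtr_sum, sub_le_iff_le_add,
      div_le_iff₀' heta, Matrix.mul_assoc (S.G m), rtr_mul_comm (S.G m), add_comm (rtr _)]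
  constructor
  · rintro ⟨h1, h2, h3, h4, h5, h6⟩
    exact ⟨fun k => (S.le_sinr_iff hsigAnt hsigS (hGreq k) w h6 (h5 k).1).mp (h1 k),
      fun m k => (S.eveCapacity_le_iff hsigAnt hsigS (hReav m k) w h6).mp (h2 m k),
      fun k => (S.le_harvested_iff heta w V (h5 k).2).mp (h3 k), fun m => (hC4 m).mp (h4 m), h5, h6,
      fun k => posSemidef_outer _⟩
  · rintro ⟨h1, h2, h3, h4, h5, h6, -⟩
    exact ⟨fun k => (S.le_sinr_iff hsigAnt hsigS (hGreq k) w h6 (h5 k).1).mpr (h1 k),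
      fun m k => (S.eveCapacity_le_iff hsigAnt hsigS (hReav m k) w h6).mpr (h2 m k),
      fun k => (S.le_harvested_iff heta w V (h5 k).2).mpr (h3 k), fun m => (hC4 m).mpr (h4 m), h5,
      h6⟩

/-! ### Moving remainders into the energy signal -/

variable {S}

/-- Interference is nonnegative and noise positive, so C1 needs a positive signal. This is what
makes the rank-one part nondegenerate. -/
lemma SDPFeasible.rtr_H_mul_pos (hsigAnt : 0 < S.sigAnt2) (hsigS : 0 < S.sigS2)
    (hGreq : ∀ k, 0 < S.Greq k) {W : Fin K → Matrix (Fin NT) (Fin NT) ℂ}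
    {V : Matrix (Fin NT) (Fin NT) ℂ} {ρ : Fin K → ℝ} (hf : S.SDPFeasible W V ρ) (k : Fin K) :
    0 < rtr (S.H k * W k) := by
  obtain ⟨hρ, h⟩ := hf.C1 k
  have h1 : 0 ≤ ∑ j ∈ Finset.univ.erase k, rtr (S.H k * W j) :=
    Finset.sum_nonneg fun j _ => S.rtr_H_mul_nonneg (hf.C7 j) k
  have h2 := S.rtr_H_mul_nonneg hf.C6 k
  have h3 : 0 < 1 / ρ k * S.sigS2 := by positivity
  exact pos_of_mul_pos_right (a := 1 / S.Greq k) (by linarith)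
    (one_div_pos.mpr (hGreq k)).le

variable (S) in
/-- The rank-one parts of the covariance matrices, in the directions of the channels. -/
def rankOnePart (W : Fin K → Matrix (Fin NT) (Fin NT) ℂ) (k : Fin K) :
    Matrix (Fin NT) (Fin NT) ℂ :=
  outer (rankOneVec (S.h k) (W k))

lemma sdpObj_move (W W' : Fin K → Matrix (Fin NT) (Fin NT) ℂ) (V : Matrix (Fin NT) (Fin NT) ℂ) :
    sdpObj W' (V + ∑ k, (W k - W' k)) = sdpObj W V := by
  simp only [sdpObj, rtr_add, rtr_sum, rtr_sub, Finset.sum_sub_distrib]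
  ring

/-- Moving positive semidefinite parts of the `W k`, invisible to the `k`-th channel, into `V`
preserves feasibility. -/
lemma SDPFeasible.move (hReav : ∀ m k, 0 < S.Reav m k)
    {W W' : Fin K → Matrix (Fin NT) (Fin NT) ℂ}
    {V : Matrix (Fin NT) (Fin NT) ℂ} {ρ : Fin K → ℝ} (hf : S.SDPFeasible W V ρ)
    (hpsd : ∀ k, (W' k).PosSemidef) (hsub : ∀ k, (W k - W' k).PosSemidef)
    (hH : ∀ k, rtr (S.H k * W' k) = rtr (S.H k * W k)) :
    S.SDPFeasible W' (V + ∑ k, (W k - W' k)) ρ := by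
  have hsum : V + ∑ k, (W k - W' k) + ∑ k, W' k = V + ∑ k, W k := by
    rw [Finset.sum_sub_distrib]
    abel
  have hD : (∑ k, (W k - W' k)).PosSemidef := posSemidef_sum _ fun k _ => hsub k
  refine ⟨fun k => ⟨(hf.C1 k).1, (hf.C1 k).2.trans_eq ?_⟩, fun m k => ?_, ?_, ?_, hf.C5,
    hf.C6.add hD, hpsd⟩
  -- Interference from the others plus `V` is the total received power minus the own signal, and
  -- neither of these changes.
  · rw [mul_add, rtr_add, Finset.mul_sum, rtr_sum, hH]
    simp only [mul_sub, rtr_sub, Finset.sum_sub_distrib]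
    rw [Finset.sum_erase_eq_sub (Finset.mem_univ k), Finset.sum_erase_eq_sub (Finset.mem_univ k), hH]
    ring
  · have hxi : (0 : ℂ) ≤ ((S.xi m k - 1 : ℝ) : ℂ) :=
      Complex.zero_le_real.mpr (sub_nonneg.mpr (S.one_lt_xi (hReav m k)).le)
    -- New slack: the old slack, plus `ξ - 1` times the growth of `Q`, plus the removed part of `W
    -- k` seen through `G m`.
    convert ((hf.C2 m k).add ((hD.conjTranspose_mul_mul_same (S.G m)).smul hxi)).add
      ((hsub k).conjTranspose_mul_mul_same (S.G m)) using 1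
    simp only [Q, Matrix.mul_add, Matrix.add_mul, Matrix.mul_sub, Matrix.sub_mul, smul_add]
    abel
  · simpa only [hsum] using hf.C3
  · simpa only [hsum] using hf.C4

section RankOnePart

variable (hsigAnt : 0 < S.sigAnt2) (hsigS : 0 < S.sigS2) (hGreq : ∀ k, 0 < S.Greq k)
  {W : Fin K → Matrix (Fin NT) (Fin NT) ℂ} {V : Matrix (Fin NT) (Fin NT) ℂ} {ρ : Fin K → ℝ}
include hsigAnt hsigS hGreq

lemma SDPFeasible.H_mul_rankOnePart (hf : S.SDPFeasible W V ρ) (k : Fin K) :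
    S.H k * S.rankOnePart W k = S.H k * W k :=
  outer_mul_outer_rankOneVec (hf.C7 k) (hf.rtr_H_mul_pos hsigAnt hsigS hGreq k).ne'

lemma SDPFeasible.posSemidef_sub_rankOnePart (hf : S.SDPFeasible W V ρ) (k : Fin K) :
    (W k - S.rankOnePart W k).PosSemidef :=
  posSemidef_sub_outer_rankOneVec (hf.C7 k) (hf.rtr_H_mul_pos hsigAnt hsigS hGreq k).ne'

lemma SDPFeasible.rank_rankOnePart (hf : S.SDPFeasible W V ρ) (k : Fin K) :
    (S.rankOnePart W k).rank = 1 := by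
  refine rank_outer fun h0 => ?_
  have h1 := hf.H_mul_rankOnePart hsigAnt hsigS hGreq k
  have h2 := hf.rtr_H_mul_pos hsigAnt hsigS hGreq k
  rw [← h1, rankOnePart, h0] at h2
  simp [outer, rtr] at h2

lemma SDPFeasible.rankOnePart (hReav : ∀ m k, 0 < S.Reav m k) (hf : S.SDPFeasible W V ρ) :
    S.SDPFeasible (S.rankOnePart W) (V + ∑ k, (W k - S.rankOnePart W k)) ρ :=
  hf.move hReav (fun _ => posSemidef_outer _)
    (hf.posSemidef_sub_rankOnePart hsigAnt hsigS hGreq)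
    fun k => congrArg rtr (hf.H_mul_rankOnePart hsigAnt hsigS hGreq k)

end RankOnePart

end WIPTSystem

/-! ### Lagrangian duality -/

/-- A Hermitian matrix is zero if the associated trace functional is bounded below on the Hermitian
matrices. -/
lemma eq_zero_of_forall_le_rtr_mul {n : ℕ} {C : Matrix (Fin n) (Fin n) ℂ} (hC : C.IsHermitian)
    {b : ℝ} (h : ∀ A : Matrix (Fin n) (Fin n) ℂ, A.IsHermitian → b ≤ rtr (C * A)) : C = 0 := by
  have hpos : 0 ≤ rtr (Cᴴ * C) := rtr_nonneg (posSemidef_conjTranspose_mul_self C)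
  have h0 : rtr (Cᴴ * C) = 0 := by
    by_contra hne
    have hp : 0 < rtr (Cᴴ * C) := lt_of_le_of_ne hpos (Ne.symm hne)
    -- The multiple of `C` is scaled so that the functional takes the value `b - 1`.
    have h1 := h ((((b - 1) / rtr (Cᴴ * C) : ℝ) : ℂ) • C) (by
      rw [IsHermitian, conjTranspose_smul, hC.eq, Complex.star_def, Complex.conj_ofReal])
    have hCC : rtr (C * C) = rtr (Cᴴ * C) := by rw [hC.eq]
    rw [mul_smul_comm, rtr_smul, hCC, div_mul_cancel₀ _ hne] at h1
    linarith
  refine trace_conjTranspose_mul_self_eq_zero_iff.mp (Complex.ext h0 ?_)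
  exact (Complex.nonneg_iff.mp (posSemidef_conjTranspose_mul_self C).trace_nonneg).2.symm

namespace WIPTSystem

variable {NT NR K M : ℕ} (S : WIPTSystem NT NR K M)

/-- The coefficient of `W k` in the Lagrangian. -/
def lagrangianCoeff (D : Dual NT NR K M) (k : Fin K) : Matrix (Fin NT) (Fin NT) ℂ :=
  S.U D k - D.Z k - ((D.α k / S.Greq k + D.β k : ℝ) : ℂ) • S.H k

lemma rtr_lagrangianCoeff_mul (D : Dual NT NR K M) (k : Fin K) (A : Matrix (Fin NT) (Fin NT) ℂ) :
    rtr (S.lagrangianCoeff D k * A) = rtr A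
      + ∑ m, rtr (D.X m k * ((S.G m)ᴴ * A * S.G m))
      - ∑ m, D.ν m * rtr (S.G m * (S.G m)ᴴ * A)
      + ∑ j ∈ Finset.univ.erase k, D.α j * rtr (S.H j * A)
      - ∑ j, D.β j * rtr (S.H j * A)
      - rtr (D.Z k * A) - D.α k / S.Greq k * rtr (S.H k * A) := by
  have hX : ∀ m, rtr (S.G m * (D.X m k - (D.ν m : ℂ) • (1 : Matrix (Fin NR) (Fin NR) ℂ))
      * (S.G m)ᴴ * A) = rtr (D.X m k * ((S.G m)ᴴ * A * S.G m))
        - D.ν m * rtr (S.G m * (S.G m)ᴴ * A) := by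
    intro m
    rw [Matrix.mul_sub, Matrix.sub_mul, Matrix.sub_mul, rtr_sub, Matrix.mul_smul, Matrix.mul_one,
      Matrix.smul_mul, Matrix.smul_mul, rtr_smul]
    congr 1
    rw [Matrix.mul_assoc, Matrix.mul_assoc, rtr_mul_comm]
    simp only [Matrix.mul_assoc]
  simp only [lagrangianCoeff, U, sub_mul, add_mul, one_mul, rtr_sub, rtr_add, Finset.sum_mul,
    rtr_sum, hX, smul_mul_assoc, rtr_smul, Finset.sum_sub_distrib]
  -- `U` omits `j = k`; the term `β_k H_k` of the coefficient completes the sum.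
  rw [← Finset.add_sum_erase _ (fun j => D.β j * rtr (S.H j * A)) (Finset.mem_univ k)]
  ring

/-- Each `W k` also enters the constraints of the other receivers; exchanging the double sums
collects its coefficient. -/
lemma lagrangian_eq (D : Dual NT NR K M) (W : Fin K → Matrix (Fin NT) (Fin NT) ℂ)
    (V : Matrix (Fin NT) (Fin NT) ℂ) (ρ : Fin K → ℝ) :
    S.lagrangian D W V ρ
      = S.lagrangian D 0 V ρ + ∑ k, rtr (S.lagrangianCoeff D k * W k) := by
  have hα : ∑ k, ∑ j ∈ Finset.univ.erase k, D.α j * rtr (S.H j * W k)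
      = ∑ k, ∑ j ∈ Finset.univ.erase k, D.α k * rtr (S.H k * W j) :=
    Finset.sum_comm' fun _ _ => by simp [ne_comm]
  have hβ : ∑ k, ∑ j, D.β j * rtr (S.H j * W k) = ∑ k, ∑ j, D.β k * rtr (S.H k * W j) :=
    Finset.sum_comm
  have hν : ∑ k, ∑ m, D.ν m * rtr (S.G m * (S.G m)ᴴ * W k)
      = ∑ m, ∑ k, D.ν m * rtr (S.G m * (S.G m)ᴴ * W k) := Finset.sum_comm
  have hX : ∑ k, ∑ m, rtr (D.X m k * ((S.G m)ᴴ * W k * S.G m))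
      = ∑ m, ∑ k, rtr (D.X m k * ((S.G m)ᴴ * W k * S.G m)) := Finset.sum_comm
  have hdiv : ∀ k, D.α k / S.Greq k * rtr (S.H k * W k)
      = D.α k * (1 / S.Greq k * rtr (S.H k * W k)) := fun k => by ring
  simp only [rtr_lagrangianCoeff_mul, lagrangian, Finset.sum_add_distrib, Finset.sum_sub_distrib,
    hα, hβ, hν, hX, hdiv, Pi.zero_apply, mul_zero, rtr_zero, Finset.sum_const_zero,
    mul_add, mul_sub, rtr_add, rtr_sub, rtr_sum, Finset.mul_sum, Matrix.mul_zero, Matrix.zero_mul,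
    add_zero, zero_add, neg_mul, mul_neg, Finset.sum_neg_distrib]
  ring

variable {S}

/-- Weak duality with the slack of the constraints `W k ⪰ 0` kept. The coordinates `ρ k = 1` have
to be approximated, at the cost of a factor `1 + ε`. -/
lemma SDPFeasible.exists_lagrangian_le (hsigAnt : 0 < S.sigAnt2) (hsigS : 0 < S.sigS2)
    (heta : 0 < S.eta)
    {W : Fin K → Matrix (Fin NT) (Fin NT) ℂ} {V : Matrix (Fin NT) (Fin NT) ℂ} {ρ : Fin K → ℝ}
    (hf : S.SDPFeasible W V ρ) {D : Dual NT NR K M} (hα : ∀ k, 0 ≤ D.α k) (hβ : ∀ k, 0 ≤ D.β k)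
    (hν : ∀ m, 0 ≤ D.ν m) (hX : ∀ m k, (D.X m k).PosSemidef) (hY : D.Y.PosSemidef)
    {ε : ℝ} (hε : 0 < ε) :
    ∃ ρ₁ : Fin K → ℝ, (∀ k, 0 < ρ₁ k ∧ ρ₁ k < 1) ∧
      S.lagrangian D W V ρ₁ ≤
        sdpObj W V - ∑ k, rtr (D.Z k * W k) + ε * ∑ k, D.α k * S.sigS2 := by
  -- With `ρ₁ k = (1 + ε)⁻¹` the term `1 / ρ₁ k` exceeds its value at `ρ k = 1` by exactly `ε`.
  have hr : 0 < (1 + ε)⁻¹ ∧ (1 + ε)⁻¹ < 1 := ⟨by positivity, inv_lt_one_of_one_lt₀ (by linarith)⟩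
  refine ⟨fun k => if ρ k < 1 then ρ k else (1 + ε)⁻¹, fun k => ?_, ?_⟩
  · dsimp only
    split_ifs with h
    · exact ⟨(hf.C1 k).1, h⟩
    · exact hr
  set ρ₁ : Fin K → ℝ := fun k => if ρ k < 1 then ρ k else (1 + ε)⁻¹ with hρ₁
  have h1 : 0 ≤ rtr (D.Y * V) := rtr_mul_nonneg hY hf.C6
  have h2 : ∑ k, D.α k * (-(1 / S.Greq k) * rtr (S.H k * W k)
      + ∑ j ∈ Finset.univ.erase k, rtr (S.H k * W j) + rtr (S.H k * V)
      + S.sigAnt2 + 1 / ρ₁ k * S.sigS2) ≤ ε * ∑ k, D.α k * S.sigS2 := by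
    rw [Finset.mul_sum]
    refine Finset.sum_le_sum fun k _ => ?_
    rw [mul_left_comm]
    refine mul_le_mul_of_nonneg_left ?_ (hα k)
    have hc := (hf.C1 k).2
    have hle : 1 / ρ₁ k ≤ 1 / ρ k + ε := by
      by_cases h : ρ k < 1
      · simp only [hρ₁, if_pos h]
        linarith
      · have : ρ k = 1 := le_antisymm (hf.C5 k).2 (not_lt.mp h)
        simp [hρ₁, this]
    have := mul_le_mul_of_nonneg_right hle hsigS.le
    linarith
  have h3 : ∑ k, D.β k * (S.Pmin k / (S.eta * (1 - ρ₁ k)) - S.sigAnt2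
      - rtr (S.H k * (V + ∑ j, W j))) ≤ 0 := by
    refine Finset.sum_nonpos fun k _ => mul_nonpos_of_nonneg_of_nonpos (hβ k) ?_
    -- At `ρ k = 1` the demand is nonpositive, so the quotient at `ρ₁ k` is too.
    rcases hf.C3 k with ⟨hρ, hP⟩ | ⟨hρ, hP⟩
    · have hVW := S.rtr_H_mul_nonneg (hf.C6.add (posSemidef_sum Finset.univ fun j _ => hf.C7 j)) k
      have : S.Pmin k / (S.eta * (1 - ρ₁ k)) ≤ 0 := by
        refine div_nonpos_of_nonpos_of_nonneg hP (mul_nonneg heta.le ?_)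
        simp only [hρ₁, hρ, lt_irrefl, if_false]
        linarith
      linarith
    · simp only [hρ₁, if_pos hρ]
      linarith
  have h4 : ∑ m, D.ν m * (S.PI m / S.eta - NR * S.sigAnt2
      - rtr (S.G m * (S.G m)ᴴ * (V + ∑ k, W k))) ≤ 0 := by
    refine Finset.sum_nonpos fun m _ => mul_nonpos_of_nonneg_of_nonpos (hν m) ?_
    have := hf.C4 m
    rw [Matrix.mul_assoc (S.G m), rtr_mul_comm (S.G m)]
    linarith
  have h5 : ∑ m, ∑ k, rtr (D.X m k *
      ((S.G m)ᴴ * W k * S.G m - ((S.xi m k - 1 : ℝ) : ℂ) • S.Q V m)) ≤ 0 := by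
    refine Finset.sum_nonpos fun m _ => Finset.sum_nonpos fun k _ => ?_
    have := rtr_mul_nonneg (hX m k) (hf.C2 m k)
    rw [mul_sub, rtr_sub] at *
    linarith
  rw [lagrangian, sdpObj]
  linarith

lemma isHermitian_U {D : Dual NT NR K M} (hX : ∀ m k, (D.X m k).PosSemidef) (k : Fin K) :
    (S.U D k).IsHermitian := by
  refine (isHermitian_one.add ?_).add ?_
  · refine isSelfAdjoint_sum _ fun m _ => ?_
    refine isHermitian_mul_mul_conjTranspose _ ((hX m k).1.sub ?_)
    rw [IsHermitian, conjTranspose_smul, conjTranspose_one, Complex.star_def, Complex.conj_ofReal]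
  · refine isSelfAdjoint_sum _ fun j _ => ?_
    change IsHermitian _
    rw [IsHermitian, conjTranspose_smul, Complex.star_def, Complex.conj_ofReal, H,
      (posSemidef_outer _).1.eq]

/-- Varying `W k` alone over the Hermitian matrices, from zero with `ρ = 1 / 2`, leaves a linear
functional bounded below. -/
lemma IsOptimalDual.lagrangianCoeff_eq_zero {W : Fin K → Matrix (Fin NT) (Fin NT) ℂ}
    {V : Matrix (Fin NT) (Fin NT) ℂ} {D : Dual NT NR K M} (hD : S.IsOptimalDual W V D)
    (k : Fin K) : S.lagrangianCoeff D k = 0 := by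
  have hC : (S.lagrangianCoeff D k).IsHermitian := by
    refine ((isHermitian_U hD.X_psd k).sub (hD.Z_psd k).1).sub ?_
    rw [IsHermitian, conjTranspose_smul, Complex.star_def, Complex.conj_ofReal, H,
      (posSemidef_outer _).1.eq]
  refine eq_zero_of_forall_le_rtr_mul hC
    (b := sdpObj W V - S.lagrangian D 0 0 fun _ => 1 / 2) fun A hA => ?_
  have h := hD.value (Pi.single k A) 0 (fun _ => 1 / 2) (fun j => ?_) isHermitian_zero
    fun _ => by norm_num
  · rw [lagrangian_eq, Finset.sum_eq_single k (fun j _ hj => by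
      rw [Pi.single_eq_of_ne hj, mul_zero, rtr_zero]) (by simp), Pi.single_eq_same] at h
    linarith
  · rcases eq_or_ne j k with rfl | hj
    · rwa [Pi.single_eq_same]
    · rw [Pi.single_eq_of_ne hj]
      exact isHermitian_zero

/-- Complementary slackness for the constraints `W k ⪰ 0`. -/
lemma IsOptimalDual.Z_mul_eq_zero (hsigAnt : 0 < S.sigAnt2) (hsigS : 0 < S.sigS2)
    (heta : 0 < S.eta)
    {W : Fin K → Matrix (Fin NT) (Fin NT) ℂ} {V : Matrix (Fin NT) (Fin NT) ℂ} {ρ : Fin K → ℝ}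
    (hf : S.SDPFeasible W V ρ) {D : Dual NT NR K M} (hD : S.IsOptimalDual W V D) (k : Fin K) :
    D.Z k * W k = 0 := by
  have hnn : ∀ k ∈ Finset.univ, 0 ≤ rtr (D.Z k * W k) :=
    fun k _ => rtr_mul_nonneg (hD.Z_psd k) (hf.C7 k)
  have hA : 0 ≤ ∑ k, D.α k * S.sigS2 :=
    Finset.sum_nonneg fun k _ => mul_nonneg (hD.α_nonneg k) hsigS.le
  have hle : ∑ k, rtr (D.Z k * W k) ≤ 0 := by
    refine le_of_forall_pos_le_add fun δ hδ => ?_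
    -- The `+ 1` keeps the denominator positive; the error from approximating `ρ k = 1` stays at
    -- most `δ`.
    have hε : 0 < δ / (∑ k, D.α k * S.sigS2 + 1) := by positivity
    obtain ⟨ρ₁, hρ₁, h⟩ := hf.exists_lagrangian_le hsigAnt hsigS heta hD.α_nonneg hD.β_nonneg
      hD.ν_nonneg hD.X_psd hD.Y_psd hε
    have h' := hD.value W V ρ₁ (fun k => (hf.C7 k).1) hf.C6.1 hρ₁
    have : δ / (∑ k, D.α k * S.sigS2 + 1) * ∑ k, D.α k * S.sigS2 ≤ δ := by
      rw [div_mul_eq_mul_div, div_le_iff₀ (by positivity)]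
      nlinarith
    linarith
  exact mul_eq_zero_of_rtr_eq_zero (hD.Z_psd k) (hf.C7 k)
    ((Finset.sum_eq_zero_iff_of_nonneg hnn).mp (le_antisymm hle (Finset.sum_nonneg hnn)) k
      (Finset.mem_univ k))

/-- Stationarity gives `U = Z + c H`. `Z` kills `W k`, hence also the rank-one part, which has `W k`
as a left factor; `H` does not distinguish the two. -/
lemma IsOptimalDual.U_mul_sub_rankOnePart (hsigAnt : 0 < S.sigAnt2) (hsigS : 0 < S.sigS2)
    (heta : 0 < S.eta) (hGreq : ∀ k, 0 < S.Greq k)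
    {W : Fin K → Matrix (Fin NT) (Fin NT) ℂ} {V : Matrix (Fin NT) (Fin NT) ℂ} {ρ : Fin K → ℝ}
    (hf : S.SDPFeasible W V ρ) {D : Dual NT NR K M} (hD : S.IsOptimalDual W V D) (k : Fin K) :
    S.U D k * (W k - S.rankOnePart W k) = 0 := by
  have hU : S.U D k = D.Z k + ((D.α k / S.Greq k + D.β k : ℝ) : ℂ) • S.H k := by
    have := hD.lagrangianCoeff_eq_zero k
    rwa [lagrangianCoeff, sub_sub, sub_eq_zero] at this
  have hZ := hD.Z_mul_eq_zero hsigAnt hsigS heta hf k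
  have hZ' : D.Z k * S.rankOnePart W k = 0 := by
    rw [WIPTSystem.rankOnePart, outer_rankOneVec (hf.C7 k), mul_smul_comm, ← mul_assoc,
      ← mul_assoc, hZ, zero_mul, zero_mul, smul_zero]
  rw [hU, add_mul, smul_mul_assoc, mul_sub, mul_sub, hf.H_mul_rankOnePart hsigAnt hsigS hGreq, hZ,
    hZ', sub_self, sub_self, smul_zero, add_zero]

/-! ### Tightness of the relaxation -/

section Tightness

variable (hsigAnt : 0 < S.sigAnt2) (hsigS : 0 < S.sigS2) (heta : 0 < S.eta)
  (hGreq : ∀ k, 0 < S.Greq k) (hReav : ∀ m k, 0 < S.Reav m k)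
include hsigAnt hsigS heta hGreq hReav

/-- Every feasible point of the relaxation yields one of the original problem of equal value. -/
lemma SDPFeasible.exists_origFeasible {W : Fin K → Matrix (Fin NT) (Fin NT) ℂ}
    {V : Matrix (Fin NT) (Fin NT) ℂ} {ρ : Fin K → ℝ} (hf : S.SDPFeasible W V ρ) :
    ∃ w V', S.OrigFeasible w V' ρ ∧ origObj w V' = sdpObj W V :=
  ⟨fun k => rankOneVec (S.h k) (W k), V + ∑ k, (W k - S.rankOnePart W k),
    (S.origFeasible_iff hsigAnt hsigS heta hGreq hReav).mpr
      (hf.rankOnePart hsigAnt hsigS hGreq hReav),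
    (origObj_eq_sdpObj _ _).trans (sdpObj_move W (S.rankOnePart W) V)⟩

lemma setOf_origObj_eq_setOf_sdpObj :
    {t | ∃ w V ρ, S.OrigFeasible w V ρ ∧ origObj w V = t}
      = {t | ∃ W V ρ, S.SDPFeasible W V ρ ∧ sdpObj W V = t} := by
  ext t
  constructor
  · rintro ⟨w, V, ρ, hf, rfl⟩
    exact ⟨_, V, ρ, (S.origFeasible_iff hsigAnt hsigS heta hGreq hReav).mp hf,
      (origObj_eq_sdpObj w V).symm⟩
  · rintro ⟨W, V, ρ, hf, rfl⟩
    obtain ⟨w, V', hf', hobj⟩ := hf.exists_origFeasible hsigAnt hsigS heta hGreq hReav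
    exact ⟨w, V', ρ, hf', hobj⟩

lemma isOptimalOrig_iff {w : Fin K → Fin NT → ℂ} {V : Matrix (Fin NT) (Fin NT) ℂ}
    {ρ : Fin K → ℝ} : S.IsOptimalOrig w V ρ ↔ S.IsOptimalSDP (fun k => outer (w k)) V ρ := by
  refine and_congr (S.origFeasible_iff hsigAnt hsigS heta hGreq hReav) ?_
  rw [← origObj_eq_sdpObj]
  constructor
  · intro h W₁ V₁ ρ₁ hf
    obtain ⟨w, V', hf', hobj⟩ := hf.exists_origFeasible hsigAnt hsigS heta hGreq hReav
    exact (h w V' ρ₁ hf').trans_eq hobj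
  · intro h w₁ V₁ ρ₁ hf
    rw [origObj_eq_sdpObj w₁]
    exact h _ V₁ ρ₁ ((S.origFeasible_iff hsigAnt hsigS heta hGreq hReav).mp hf)

end Tightness

end WIPTSystem

end

theorem theorem1 {NT NR K M : ℕ} (S : WIPTSystem NT NR K M)
    (hsigAnt : 0 < S.sigAnt2) (hsigS : 0 < S.sigS2) (heta : 0 < S.eta)
    (hGreq : ∀ k, 0 < S.Greq k) (hReav : ∀ m k, 0 < S.Reav m k) :
    -- an optimal solution of the relaxation with a matrix of rank > 1 yields a rank-one one
    (∀ W V ρ, S.IsOptimalSDP W V ρ → (∃ k, 1 < (W k).rank) →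
      ∃ Wt Vt ρt, S.SDPFeasible Wt Vt ρt ∧
        WIPTSystem.sdpObj Wt Vt = WIPTSystem.sdpObj W V ∧
        S.IsOptimalSDP Wt Vt ρt ∧
        (∀ k, (Wt k).rank = 1) ∧
        -- positive semidefinite parts supported on the null spaces of `U_k` move from `W` to `V`
        ρt = ρ ∧
        (∀ k, (W k - Wt k).PosSemidef) ∧
        Vt = V + ∑ k, (W k - Wt k) ∧
        (∀ D, S.IsOptimalDual W V D → ∀ k, S.U D k * (W k - Wt k) = 0)) ∧
    -- tightness: rank-one optimal solutions of the relaxation are global optima of the original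
    (∀ W V ρ, S.IsOptimalSDP W V ρ → (∀ k, (W k).rank = 1) →
      ∃ w, (∀ k, W k = outer (w k)) ∧ S.IsOptimalOrig w V ρ ∧
        WIPTSystem.origObj w V = WIPTSystem.sdpObj W V) ∧
    (∀ w V ρ, S.IsOptimalOrig w V ρ → S.IsOptimalSDP (fun k => outer (w k)) V ρ) ∧
    (∀ t : ℝ,
      IsLeast {t | ∃ w V ρ, S.OrigFeasible w V ρ ∧ WIPTSystem.origObj w V = t} t ↔
      IsLeast {t | ∃ W V ρ, S.SDPFeasible W V ρ ∧ WIPTSystem.sdpObj W V = t} t) := by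
  refine ⟨fun W V ρ hW _ => ?_, fun W V ρ hW hr => ?_, fun w V ρ h =>
    (WIPTSystem.isOptimalOrig_iff hsigAnt hsigS heta hGreq hReav).mp h, fun t => by
    rw [WIPTSystem.setOf_origObj_eq_setOf_sdpObj hsigAnt hsigS heta hGreq hReav]⟩
  · have hf := hW.1
    have hf' := hf.rankOnePart hsigAnt hsigS hGreq hReav
    have hobj := WIPTSystem.sdpObj_move W (S.rankOnePart W) V
    exact ⟨S.rankOnePart W, _, ρ, hf', hobj,
      ⟨hf', fun W₁ V₁ ρ₁ h₁ => hobj.trans_le (hW.2 W₁ V₁ ρ₁ h₁)⟩,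
      hf.rank_rankOnePart hsigAnt hsigS hGreq, rfl,
      hf.posSemidef_sub_rankOnePart hsigAnt hsigS hGreq, rfl,
      fun D hD => hD.U_mul_sub_rankOnePart hsigAnt hsigS heta hGreq hf⟩
  · have hw : W = fun k => outer (rankOneVec (S.h k) (W k)) := funext fun k =>
      (outer_rankOneVec_of_rank (hW.1.C7 k)
        (hW.1.rtr_H_mul_pos hsigAnt hsigS hGreq k).ne' (hr k)).symm
    refine ⟨fun k => rankOneVec (S.h k) (W k), congrFun hw, ?_, ?_⟩
    · rw [WIPTSystem.isOptimalOrig_iff hsigAnt hsigS heta hGreq hReav, ← hw]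
      exact hW
    · rw [WIPTSystem.origObj_eq_sdpObj, ← hw]
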